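/- Let $f:\mathbb{R}^n\to(-\infty,\infty]$ and $g:\mathbb{R}^m\to(-\infty,\infty]$ be proper, lower semicontinuous and convex, let $A\in\mathbb{R}^{m\times n}$, $B\in\mathbb{R}^{r\times n}$, $b\in\mathbb{R}^r$, and let $\lambda,\mu\in\mathbb{R}^r$ have strictly positive entries. Define $$F(x)=f(x)+g(Ax)+\sum_{i=1}^r\lambda_i\,\mathbf 1_{\{(Bx-b)_i>0\}}\qquad(x\in\mathbb{R}^n),$$ and, with the conjugates $f^*(q)=\sup_x\,(\langle q,x\rangle-f(x))$ and $g^*(y)=\sup_s\,(\langle y,s\rangle-g(s))$, define the stationary dual objective $$G(y,z)=\langle b,z\rangle+f^*(-A^\top y-B^\top z)+g^*(y)+\Psi_{+}(z)\qquad(y\in\mathbb{R}^m,\ z\in\mathbb{R}^r),$$ where $\Psi_{+}(z)=\sum_{i=1}^r\mu_i\,\mathbf 1_{\{z_i\neq0\}}$ if $z\ge0$ componentwise and $\Psi_{+}(z)=+\infty$ otherwise. Suppose that $F$ is bounded below and that there is a point $x\in\mathbb{R}^n$ with $x\in\operatorname{ri}(\operatorname{dom} f)$, $Ax\in\operatorname{ri}(\operatorname{dom}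 g)$ and $Bx\le b$ componentwise. Here $\operatorname{dom}\psi=\{\psi<\infty\}$, $\operatorname{ri}$ denotes the relative interior, and "$\operatorname{ri}$" may be omitted for $f$ (respectively $g$) if $f$ (respectively $g$) is polyhedral, i.e. its epigraph is an intersection of finitely many closed half-spaces. Then the stationary dual problem $\inf_{(y,z)}G(y,z)$ has a global solution: there is $(y^*,z^*)$ such that $G(y^*,z^*)$ is finite and $G(y^*,z^*)\le G(y,z)$ for all $(y,z)\in\mathbb{R}^m\times\mathbb{R}^r$. -/

import Mathlib

/-!  Composite cardinality optimization and its stationary dual.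
Functions into `(-∞, ∞]` are functions into `EReal` that never take the value `⊥`
(this is part of `CCOP.IsProper`). -/

noncomputable section

namespace CCOP

/-- Effective domain `{x | ψ x < ∞}`. -/
def dom {V : Type*} (ψ : V → EReal) : Set V := {x | ψ x < ⊤}

/-- The epigraph of `ψ`, a subset of `V × ℝ`. -/
def epi {V : Type*} (ψ : V → EReal) : Set (V × ℝ) := {p | ψ p.1 ≤ (p.2 : EReal)}

/-- Proper: never `-∞` and finite at some point. -/
def IsProper {V : Type*} (ψ : V → EReal) : Prop := (∀ x, ψ x ≠ ⊥) ∧ (dom ψ).Nonempty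

/-- Convex extended-real-valued function: its epigraph is convex. -/
def IsConvexFun {V : Type*} [AddCommGroup V] [Module ℝ V] (ψ : V → EReal) : Prop :=
  Convex ℝ (epi ψ)

/-- Polyhedral convex set: the intersection of finitely many half-spaces
(used in finite dimension only). -/
def IsPolyhedralSet {V : Type*} [AddCommGroup V] [Module ℝ V] (s : Set V) : Prop :=
  ∃ (k : ℕ) (φ : Fin k → (V →ₗ[ℝ] ℝ)) (β : Fin k → ℝ), s = {v | ∀ i, φ i v ≤ β i}

/-- Polyhedral function: its epigraph is a polyhedral convex set. -/
def IsPolyhedralFun {V : Type*} [AddCommGroup V] [Module ℝ V] (ψ : V → EReal) : Prop :=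
  IsPolyhedralSet (epi ψ)

/-- Fenchel conjugate `ψ* q = sup_x (⟨q, x⟩ - ψ x)`. -/
def conj {n : ℕ} (ψ : EuclideanSpace ℝ (Fin n) → EReal) (q : EuclideanSpace ℝ (Fin n)) : EReal :=
  ⨆ x : EuclideanSpace ℝ (Fin n), ((inner ℝ q x : ℝ) : EReal) - ψ x

open Classical in
/-- The indicator function `δ(· | U)`: `0` on `U` and `+∞` off `U`. -/
def delta {V : Type*} (U : Set V) (x : V) : EReal := if x ∈ U then 0 else ⊤

/-- `Φ₊(u) = ∑ λ_i 1{u_i > 0}`. -/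
def PhiPos {r : ℕ} (lam : Fin r → ℝ) (u : EuclideanSpace ℝ (Fin r)) : ℝ :=
  ∑ i, if 0 < u i then lam i else 0

/-- `Ψ₊(z) = ∑ μ_i 1{z_i ≠ 0} + δ(z | ℝ^r_+)`. -/
def PsiPos {r : ℕ} (mu : Fin r → ℝ) (z : EuclideanSpace ℝ (Fin r)) : EReal :=
  ((∑ i, if z i ≠ 0 then mu i else 0 : ℝ) : EReal) + delta {z | ∀ i, 0 ≤ z i} z

/-- Objective of the primal problem, `F(x) = f(x) + g(Ax) + Φ₊(Bx - b)`. -/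
def primalObj {n m r : ℕ} (f : EuclideanSpace ℝ (Fin n) → EReal)
    (g : EuclideanSpace ℝ (Fin m) → EReal) (A : Matrix (Fin m) (Fin n) ℝ)
    (B : Matrix (Fin r) (Fin n) ℝ) (b : EuclideanSpace ℝ (Fin r)) (lam : Fin r → ℝ)
    (x : EuclideanSpace ℝ (Fin n)) : EReal :=
  f x + g (A.toEuclideanLin x) + (PhiPos lam (B.toEuclideanLin x - b) : EReal)

/-- Objective of the stationary dual problem, at `w = [y; z]`:
`G(w) = ⟨b, z⟩ + f*(-Aᵀy - Bᵀz) + g*(y) + Ψ₊(z)`. -/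
def dualObj {n m r : ℕ} (f : EuclideanSpace ℝ (Fin n) → EReal)
    (g : EuclideanSpace ℝ (Fin m) → EReal) (A : Matrix (Fin m) (Fin n) ℝ)
    (B : Matrix (Fin r) (Fin n) ℝ) (b : EuclideanSpace ℝ (Fin r)) (mu : Fin r → ℝ)
    (w : EuclideanSpace ℝ (Fin m) × EuclideanSpace ℝ (Fin r)) : EReal :=
  ((inner ℝ b w.2 : ℝ) : EReal)
    + conj f (-(A.transpose.toEuclideanLin w.1) - B.transpose.toEuclideanLin w.2)
    + conj g w.1 + PsiPos mu w.2

/-- `x ∈ ri (dom ψ)`, where `ri` is dropped if `ψ` is polyhedral. -/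
def SlaterPoint {n : ℕ} (ψ : EuclideanSpace ℝ (Fin n) → EReal)
    (x : EuclideanSpace ℝ (Fin n)) : Prop :=
  x ∈ intrinsicInterior ℝ (dom ψ) ∨ (IsPolyhedralFun ψ ∧ x ∈ dom ψ)

end CCOP

end

/-!
For a set `I` of indices, restrict the dual variable `z` to `z ≥ 0` with support in `I` and drop the
cardinality term. What remains, `convexDualObj`, is the Lagrange dual of the convex problem of
minimizing `f x + g (A x)` subject to `(B x)_i ≤ b_i` for `i ∈ I`. This problem is feasible by the
Slater condition, and bounded below because `F` is and because the cardinality term of `F` is at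
most `∑ λ_i`. Strong duality therefore gives a finite minimum of the restricted dual, attained at
some `w I` (`exists_convexDualObj_min`). Among the finitely many points `w I`, one with the least
value of `G` is a global solution: if `G w'` is finite and `I` is the support of the `z`-part of
`w'`, then `w I` has the smaller convex part, and the smaller cardinality term because its support
lies in `I`.

Strong duality under the mixed condition (relative interior, or mere membership for a polyhedral
function) comes from a single theorem on Lagrange multipliers, `exists_multipliers`: minimize an
affine function over a convex set `C` subject to affine equations and inequalities that hold at
some relative interior point of `C`. It is applied to the variables `(x, t, s, τ)`, with objective
`t + τ` and constraints `A x = s`, `(B x)_i ≤ b_i`, `(x, t) ∈ epi f` and `(s, τ) ∈ epi g`. The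
epigraph of a function whose Slater point is in the relative interior of the domain goes into `C`,
while that of a polyhedral function is written as further affine inequalities
(`SlaterPoint.exists_epi_eq_inter`).

The multiplier theorem is proved by separating the origin from the set of all pairs of an objective
value and perturbations of the constraints. If the separating functional is not vertical, its
coefficients are the multipliers. Otherwise they exhibit an affine dependence of the constraints
on `C`, one constraint can be dropped, and induction on the number of constraints applies. Only an
algebraic form of the relative interior, `MemAlgRelint`, is needed.
-/

namespace CCOP

/-! ### Separation of a point from a convex set in finite dimension -/

/-- A convex set in finite dimension that misses the origin lies in a closed half-space bounded by
a hyperplane through the origin. No topological assumption is needed: a convex set without interior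
points lies in a hyperplane. -/
theorem exists_ne_zero_forall_nonneg {E : Type*} [NormedAddCommGroup E] [NormedSpace ℝ E]
    [FiniteDimensional ℝ E] {D : Set E} (hD : Convex ℝ D) (hne : D.Nonempty)
    (h0 : (0 : E) ∉ D) : ∃ L : E →ₗ[ℝ] ℝ, L ≠ 0 ∧ ∀ x ∈ D, 0 ≤ L x := by
  by_cases hint : (interior D).Nonempty
  · obtain ⟨L, hL⟩ := geometric_hahn_banach_point_open hD.interior isOpen_interior
      (fun h => h0 (interior_subset h))
    simp only [map_zero] at hL
    refine ⟨L.toLinearMap, ?_, fun x hx => ?_⟩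
    · rintro h
      obtain ⟨x, hx⟩ := hint
      have h1 := hL x hx
      have h2 : L x = 0 := LinearMap.congr_fun h x
      exact absurd h2 h1.ne'
    · have hcl : closure (interior D) ⊆ {x | 0 ≤ L x} :=
        closure_minimal (fun x hx => (hL x hx).le) (isClosed_le continuous_const L.continuous)
      rw [hD.closure_interior_eq_closure_of_nonempty_interior hint] at hcl
      exact hcl (subset_closure hx)
  · have hspan : affineSpan ℝ D ≠ ⊤ := fun h =>
      hint (hD.interior_nonempty_iff_affineSpan_eq_top.2 h)
    obtain ⟨x₀, hx₀⟩ := hne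
    have hdir : (affineSpan ℝ D).direction < ⊤ := by
      refine lt_top_iff_ne_top.2 fun h => hspan ?_
      exact (AffineSubspace.direction_eq_top_iff_of_nonempty
        ⟨x₀, subset_affineSpan ℝ D hx₀⟩).1 h
    obtain ⟨L, hL0, hL⟩ := Submodule.exists_le_ker_of_lt_top _ hdir
    have hconst : ∀ x ∈ D, L x = L x₀ := fun x hx => by
      have : x -ᵥ x₀ ∈ (affineSpan ℝ D).direction :=
        AffineSubspace.vsub_mem_direction (subset_affineSpan ℝ D hx) (subset_affineSpan ℝ D hx₀)
      have h := hL this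
      rw [LinearMap.mem_ker, vsub_eq_sub, map_sub] at h
      linarith
    rcases le_total 0 (L x₀) with h | h
    · exact ⟨L, hL0, fun x hx => (hconst x hx).symm ▸ h⟩
    · refine ⟨-L, neg_ne_zero.2 hL0, fun x hx => ?_⟩
      rw [LinearMap.neg_apply, hconst x hx]
      linarith

/-! ### Algebraic relative interior -/

/-- `x` is an algebraic relative interior point of `C`: every segment of `C` that ends at `x` can
be prolonged beyond `x` inside `C`. -/
def MemAlgRelint {V : Type*} [AddCommGroup V] [Module ℝ V] (C : Set V) (x : V) : Prop :=
  x ∈ C ∧ ∀ y ∈ C, ∃ ε : ℝ, 0 < ε ∧ (1 + ε) • x + (-ε) • y ∈ C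

section AlgRelint

variable {V W : Type*} [AddCommGroup V] [Module ℝ V] [AddCommGroup W] [Module ℝ W]

theorem prolong_mem_of_le {C : Set V} (hC : Convex ℝ C) {x y : V} (hx : x ∈ C) {ε δ : ℝ}
    (hδ : 0 < δ) (hδε : δ ≤ ε) (h : (1 + ε) • x + (-ε) • y ∈ C) :
    (1 + δ) • x + (-δ) • y ∈ C := by
  have hε : 0 < ε := hδ.trans_le hδε
  have := hC hx h (a := 1 - δ / ε) (b := δ / ε) (by rw [sub_nonneg, div_le_one hε]; exact hδε)
    (by positivity) (by ring)
  convert this using 1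
  match_scalars <;> field_simp
  ring

theorem MemAlgRelint.prod {C : Set V} {C' : Set W} (hC : Convex ℝ C) (hC' : Convex ℝ C')
    {x : V} {x' : W} (h : MemAlgRelint C x) (h' : MemAlgRelint C' x') :
    MemAlgRelint (C ×ˢ C') (x, x') := by
  refine ⟨⟨h.1, h'.1⟩, fun y hy => ?_⟩
  obtain ⟨ε, hε, h1⟩ := h.2 y.1 hy.1
  obtain ⟨ε', hε', h2⟩ := h'.2 y.2 hy.2
  have hm : 0 < min ε ε' := lt_min hε hε'
  exact ⟨min ε ε', hm, prolong_mem_of_le hC h.1 hm (min_le_left _ _) h1,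
    prolong_mem_of_le hC' h'.1 hm (min_le_right _ _) h2⟩

theorem memAlgRelint_univ (x : V) : MemAlgRelint Set.univ x :=
  ⟨trivial, fun _ _ => ⟨1, one_pos, trivial⟩⟩

/-- An affine function that is nonnegative on `C` and attains `0` at a relative interior point
vanishes on `C`. -/
theorem MemAlgRelint.eq_zero_of_nonneg {C : Set V} {x : V} (h : MemAlgRelint C x)
    (a : V →ᵃ[ℝ] ℝ) (ha : ∀ y ∈ C, 0 ≤ a y) (hx : a x ≤ 0) : ∀ y ∈ C, a y = 0 := by
  intro y hy
  obtain ⟨ε, hε, h1⟩ := h.2 y hy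
  have h2 := ha _ h1
  rw [Convex.combo_affine_apply (by ring), smul_eq_mul, smul_eq_mul] at h2
  have h3 := ha y hy
  nlinarith

theorem memAlgRelint_of_mem_intrinsicInterior {E : Type*} [NormedAddCommGroup E]
    [NormedSpace ℝ E] {C : Set E} {x : E} (hx : x ∈ intrinsicInterior ℝ C) :
    MemAlgRelint C x := by
  refine ⟨intrinsicInterior_subset hx, fun y hy => ?_⟩
  obtain ⟨x', hx', rfl⟩ := mem_intrinsicInterior.1 hx
  have hy' := subset_affineSpan ℝ C hy
  let γ : ℝ → affineSpan ℝ C := fun ε =>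
    ⟨AffineMap.lineMap (x' : E) y (-ε), AffineMap.lineMap_mem _ x'.2 hy'⟩
  have hγ : Continuous γ :=
    Continuous.subtype_mk ((AffineMap.lineMap_continuous).comp continuous_neg) _
  have hγ0 : γ 0 = x' := by ext; simp [γ]
  have hev : ∀ᶠ ε in nhds (0 : ℝ), γ ε ∈ interior ((↑) ⁻¹' C : Set (affineSpan ℝ C)) :=
    hγ.continuousAt.eventually_mem (by rw [hγ0]; exact isOpen_interior.mem_nhds hx')
  obtain ⟨ε, hε, hpos⟩ := ((hev.filter_mono nhdsWithin_le_nhds).and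
    (self_mem_nhdsWithin : Set.Ioi (0 : ℝ) ∈ nhdsWithin 0 (Set.Ioi 0))).exists
  refine ⟨ε, hpos, ?_⟩
  have h := interior_subset hε
  simp only [Set.mem_preimage, γ, AffineMap.lineMap_apply_module] at h
  rwa [sub_neg_eq_add] at h

end AlgRelint

/-! ### Lagrange multipliers for affine constraints -/

/-- Lagrange multipliers: if `c ≥ 0` at all points of `C` that satisfy the inequalities `a i ≤ 0`,
`i ∈ s`, and the equations `a i = 0`, `i ∈ e`, and if these constraints hold at a relative interior
point of `C`, not necessarily strictly, then the Lagrangian for suitable multipliers is nonnegative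
on `C`. Equations are kept apart from inequalities because the induction on the number of
constraints turns inequalities into equations. -/
theorem exists_multipliers {V ι : Type*} [AddCommGroup V] [Module ℝ V] [Fintype ι]
    {C : Set V} (hC : Convex ℝ C) {x₀ : V} (hx₀ : MemAlgRelint C x₀) (c : V →ᵃ[ℝ] ℝ)
    (a : ι → V →ᵃ[ℝ] ℝ) (s e : Finset ι) (hse : Disjoint s e)
    (hs : ∀ i ∈ s, a i x₀ ≤ 0) (he : ∀ i ∈ e, a i x₀ = 0)
    (hopt : ∀ x ∈ C, (∀ i ∈ s, a i x ≤ 0) → (∀ i ∈ e, a i x = 0) → 0 ≤ c x) :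
    ∃ μ : ι → ℝ, (∀ i ∈ s, 0 ≤ μ i) ∧ (∀ i, i ∉ s → i ∉ e → μ i = 0) ∧
      ∀ x ∈ C, 0 ≤ c x + ∑ i, μ i * a i x := by
  classical
  induction hk : (s ∪ e).card using Nat.strong_induction_on generalizing s e with
  | _ k ih =>
  -- `D` consists of the pairs of a strict upper bound on the objective and a perturbation of the
  -- constraints; its coordinates outside `s ∪ e` are free.
  let D : Set (ℝ × (ι → ℝ)) := {p | ∃ x ∈ C, c x < p.1 ∧ (∀ i ∈ s, a i x ≤ p.2 i) ∧
    ∀ i ∈ e, a i x = p.2 i}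
  have hD : Convex ℝ D := by
    rintro p ⟨x, hx, hp, hps, hpe⟩ q ⟨y, hy, hq, hqs, hqe⟩ α β hα hβ hαβ
    refine ⟨α • x + β • y, hC hx hy hα hβ hαβ, ?_, fun i hi => ?_, fun i hi => ?_⟩
    · rw [Convex.combo_affine_apply hαβ]
      simp only [smul_eq_mul, Prod.fst_add, Prod.smul_fst]
      rcases hα.eq_or_lt with rfl | hα'
      · have : β = 1 := by linarith
        subst this; simpa using hq
      · have := mul_lt_mul_of_pos_left hp hα'
        have := mul_le_mul_of_nonneg_left hq.le hβ
        linarith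
    · rw [Convex.combo_affine_apply hαβ]
      exact add_le_add (mul_le_mul_of_nonneg_left (hps i hi) hα)
        (mul_le_mul_of_nonneg_left (hqs i hi) hβ)
    · rw [Convex.combo_affine_apply hαβ, hpe i hi, hqe i hi]
      rfl
  have hne : D.Nonempty := ⟨(c x₀ + 1, fun i => a i x₀), x₀, hx₀.1, by simp, by simp, by simp⟩
  have h0 : (0 : ℝ × (ι → ℝ)) ∉ D := by
    rintro ⟨x, hx, h1, h2, h3⟩
    exact absurd (hopt x hx h2 h3) (not_le.2 h1)
  obtain ⟨L, hL0, hL⟩ := exists_ne_zero_forall_nonneg hD hne h0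
  set ρ : ℝ := L (1, 0) with hρ
  set μ : ι → ℝ := fun i => L (0, Pi.single i 1) with hμ
  have hLeq : ∀ w u, L (w, u) = w * ρ + ∑ i, μ i * u i := by
    intro w u
    have h1 : ((w, u) : ℝ × (ι → ℝ)) = w • (1, 0) + LinearMap.inr ℝ ℝ (ι → ℝ) u := by
      ext <;> simp
    have h2 := LinearMap.pi_apply_eq_sum_univ (L ∘ₗ LinearMap.inr ℝ ℝ (ι → ℝ)) u
    simp only [LinearMap.comp_apply] at h2
    rw [h1, map_add, map_smul, h2]
    simp only [smul_eq_mul, hρ, hμ]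
    congr 1
    refine Finset.sum_congr rfl fun i _ => ?_
    rw [mul_comm]
    congr 2
    simp only [LinearMap.inr_apply]
    congr 1
    ext j
    simp [Pi.single_apply, eq_comm]
  have hmem : ∀ x ∈ C, ∀ w, c x < w → 0 ≤ w * ρ + ∑ i, μ i * a i x := fun x hx w hw => by
    rw [← hLeq]
    exact hL _ ⟨x, hx, hw, fun _ _ => le_rfl, fun _ _ => rfl⟩
  -- The set `D` recedes in the direction `(1, 0)`, in the directions of the inequalities, and in
  -- both directions of an unused coordinate; hence the signs of the coefficients of `L`.
  have hrec : ∀ d : ℝ × (ι → ℝ), (∀ p ∈ D, ∀ τ : ℝ, 0 ≤ τ → p + τ • d ∈ D) → 0 ≤ L d := by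
    intro d hd
    obtain ⟨p, hp⟩ := hne
    by_contra! hneg
    have h1 := hL _ (hd p hp ((L p + 1) / (-L d)) (div_nonneg (by linarith [hL p hp]) (by linarith)))
    rw [map_add, map_smul, smul_eq_mul] at h1
    have : (L p + 1) / (-L d) * L d = -(L p + 1) := by field_simp [hneg.ne]
    linarith
  have hρ0 : 0 ≤ ρ := by
    refine hrec _ ?_
    rintro p ⟨x, hx, h1, h2, h3⟩ τ hτ
    exact ⟨x, hx, by simp; linarith, by simpa using h2, by simpa using h3⟩
  have hμs : ∀ i ∈ s, 0 ≤ μ i := by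
    intro i hi
    refine hrec _ ?_
    rintro p ⟨x, hx, h1, h2, h3⟩ τ hτ
    refine ⟨x, hx, by simpa using h1, fun j hj => ?_, fun j hj => ?_⟩
    · have := h2 j hj
      by_cases hij : j = i
      · subst hij; simp; linarith
      · simpa [hij] using this
    · have hij : j ≠ i := fun h => Finset.disjoint_left.1 hse hi (h ▸ hj)
      simpa [hij] using h3 j hj
  have hμ0 : ∀ i, i ∉ s → i ∉ e → μ i = 0 := by
    intro i his hie
    have hmove : ∀ p ∈ D, ∀ σ : ℝ, p + (0, Pi.single i σ) ∈ D := by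
      rintro p ⟨x, hx, h1, h2, h3⟩ σ
      refine ⟨x, hx, by simpa using h1, fun j hj => ?_, fun j hj => ?_⟩
      · have hij : j ≠ i := fun h => his (h ▸ hj)
        simpa [hij] using h2 j hj
      · have hij : j ≠ i := fun h => hie (h ▸ hj)
        simpa [hij] using h3 j hj
    refine le_antisymm ?_ (hrec _ fun p hp τ _ => ?_)
    · have h1 := hrec (-(0, Pi.single i 1)) fun p hp τ _ => by
        convert hmove p hp (-τ) using 2
        ext j
        · simp
        · by_cases hji : j = i <;> simp [hji]
      rw [map_neg] at h1
      linarith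
    · convert hmove p hp τ using 2
      ext j <;> simp [Pi.single_apply]
  rcases hρ0.eq_or_lt with hρ0 | hρpos
  swap
  · refine ⟨fun i => μ i / ρ, fun i hi => div_nonneg (hμs i hi) hρpos.le,
      fun i h1 h2 => by simp [hμ0 i h1 h2], fun x hx => ?_⟩
    have h1 : 0 ≤ c x * ρ + ∑ i, μ i * a i x := by
      refine le_of_forall_pos_le_add fun ε hε => ?_
      have h2 := hmem x hx (c x + ε / ρ) (by have := div_pos hε hρpos; linarith)
      have : (c x + ε / ρ) * ρ = c x * ρ + ε := by field_simp
      linarith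
    have h2 : c x + ∑ i, μ i / ρ * a i x = (c x * ρ + ∑ i, μ i * a i x) / ρ := by
      rw [add_div, mul_div_cancel_right₀ _ hρpos.ne', Finset.sum_div]
      congr 1
      exact Finset.sum_congr rfl fun i _ => by ring
    rw [h2]
    exact div_nonneg h1 hρpos.le
  · -- A vertical separator: the constraints are affinely dependent on `C`.
    have hsum0 : ∀ x ∈ C, 0 ≤ ∑ i, μ i * a i x := fun x hx => by
      have := hmem x hx (c x + 1) (by linarith)
      rwa [← hρ0, mul_zero, zero_add] at this
    have hterm : ∀ i, μ i * a i x₀ ≤ 0 := fun i => by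
      by_cases his : i ∈ s
      · exact mul_nonpos_of_nonneg_of_nonpos (hμs i his) (hs i his)
      · by_cases hie : i ∈ e
        · rw [he i hie, mul_zero]
        · rw [hμ0 i his hie, zero_mul]
    let A : V →ᵃ[ℝ] ℝ := ∑ i, μ i • a i
    have hA : ∀ x, A x = ∑ i, μ i * a i x := fun x => by
      have h := map_sum (AddMonoidHom.mk' (fun φ : V →ᵃ[ℝ] ℝ => φ x) fun _ _ => rfl)
        (fun i => μ i • a i) Finset.univ
      exact h
    have hdep : ∀ x ∈ C, ∑ i, μ i * a i x = 0 := fun x hx => by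
      rw [← hA]
      refine hx₀.eq_zero_of_nonneg A (fun y hy => by rw [hA]; exact hsum0 y hy) ?_ x hx
      rw [hA]
      exact Finset.sum_nonpos fun i _ => hterm i
    have hterm0 : ∀ i, μ i * a i x₀ = 0 := fun i =>
      (Finset.sum_eq_zero_iff_of_nonpos fun i _ => hterm i).1 (hdep x₀ hx₀.1) i (Finset.mem_univ i)
    obtain ⟨i₀, hi₀⟩ : ∃ i, μ i ≠ 0 := by
      by_contra! hall
      refine hL0 (LinearMap.ext fun p => ?_)
      rw [← Prod.mk.eta (p := p), hLeq, ← hρ0]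
      simp [hall]
    have hi₀mem : i₀ ∈ s ∪ e := by
      by_contra h
      rw [Finset.mem_union, not_or] at h
      exact hi₀ (hμ0 i₀ h.1 h.2)
    -- The inequalities with a positive coefficient in the dependence are active at `x₀`. With all of
    -- them made into equations, the constraint `i₀` follows from the others on `C` and is dropped.
    let J : Finset ι := s.filter fun i => μ i ≠ 0
    let s' : Finset ι := s.filter fun i => μ i = 0
    let e' : Finset ι := (e ∪ J).erase i₀
    have hs' : ∀ i, i ∈ s' ↔ i ∈ s ∧ μ i = 0 := fun i => by simp [s']
    have he' : ∀ i, i ∈ e' ↔ i ≠ i₀ ∧ (i ∈ e ∨ (i ∈ s ∧ μ i ≠ 0)) := fun i => by simp [e', J]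
    have hsub : s' ∪ e' ⊆ (s ∪ e).erase i₀ := by
      intro i hi
      rw [Finset.mem_union, hs', he'] at hi
      rw [Finset.mem_erase, Finset.mem_union]
      rcases hi with ⟨h1, h2⟩ | ⟨h1, h2 | h2⟩
      · exact ⟨fun h => hi₀ (h ▸ h2), Or.inl h1⟩
      · exact ⟨h1, Or.inr h2⟩
      · exact ⟨h1, Or.inl h2.1⟩
    have hcard : (s' ∪ e').card < k := by
      rw [← hk]
      exact (Finset.card_le_card hsub).trans_lt (Finset.card_erase_lt_of_mem hi₀mem)
    obtain ⟨ν, hν1, hν2, hν3⟩ := ih _ hcard s' e'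
      (by
        rw [Finset.disjoint_left]
        intro i h1 h2
        rw [hs'] at h1
        rw [he'] at h2
        rcases h2.2 with h | h
        · exact Finset.disjoint_left.1 hse h1.1 h
        · exact h.2 h1.2)
      (fun i hi => hs i ((hs' i).1 hi).1)
      (fun i hi => by
        rcases ((he' i).1 hi).2 with h | h
        · exact he i h
        · exact (mul_eq_zero.1 (hterm0 i)).resolve_left h.2)
      (fun x hx h1 h2 => by
        have hother : ∀ i, i ≠ i₀ → μ i * a i x = 0 := fun i hi => by
          by_cases hμi : μ i = 0
          · rw [hμi, zero_mul]
          · rw [h2 i ((he' i).2 ⟨hi, ?_⟩), mul_zero]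
            by_cases his : i ∈ s
            · exact Or.inr ⟨his, hμi⟩
            · exact Or.inl (by_contra fun hie => hμi (hμ0 i his hie))
        have hi₀x : a i₀ x = 0 := by
          have h3 := hdep x hx
          rw [Finset.sum_eq_single i₀ (fun i _ hi => hother i hi) (by simp)] at h3
          exact (mul_eq_zero.1 h3).resolve_left hi₀
        refine hopt x hx (fun i hi => ?_) (fun i hi => ?_)
        · by_cases hii : i = i₀
          · rw [hii, hi₀x]
          · by_cases hμi : μ i = 0
            · exact h1 i ((hs' i).2 ⟨hi, hμi⟩)
            · exact (h2 i ((he' i).2 ⟨hii, Or.inr ⟨hi, hμi⟩⟩)).le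
        · by_cases hii : i = i₀
          · rw [hii, hi₀x]
          · exact h2 i ((he' i).2 ⟨hii, Or.inl hi⟩))
      rfl
    -- A large multiple of the dependence makes the multipliers of `J` nonnegative.
    let T : ℝ := ∑ i, |ν i / μ i|
    refine ⟨fun i => ν i + T * μ i, fun i hi => ?_, fun i h1 h2 => ?_, fun x hx => ?_⟩
    · by_cases hμi : μ i = 0
      · simpa [hμi] using hν1 i ((hs' i).2 ⟨hi, hμi⟩)
      · have hpos : 0 < μ i := lt_of_le_of_ne (hμs i hi) (Ne.symm hμi)
        have hT : |ν i / μ i| ≤ T :=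
          Finset.single_le_sum (f := fun i => |ν i / μ i|) (fun _ _ => abs_nonneg _)
            (Finset.mem_univ i)
        have h3 : -(ν i / μ i) ≤ T := (neg_le_abs _).trans hT
        have h4 := mul_le_mul_of_nonneg_right h3 hpos.le
        have h5 : -(ν i / μ i) * μ i = - ν i := by field_simp
        linarith
    · have h3 : ν i = 0 := hν2 i (fun h => h1 ((hs' i).1 h).1) (fun h => by
        rcases ((he' i).1 h).2 with h | h
        exacts [h2 h, h1 h.1])
      simp [h3, hμ0 i h1 h2]
    · have h1 : ∑ i, (ν i + T * μ i) * a i x = ∑ i, ν i * a i x + T * ∑ i, μ i * a i x := by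
        rw [Finset.mul_sum, ← Finset.sum_add_distrib]
        exact Finset.sum_congr rfl fun i _ => by ring
      rw [h1, hdep x hx, mul_zero, add_zero]
      exact hν3 x hx

/-! ### Conjugate functions and epigraphs -/

section Conjugate

variable {n m : ℕ}

theorem inner_sub_le_conj (ψ : EuclideanSpace ℝ (Fin n) → EReal)
    (q x : EuclideanSpace ℝ (Fin n)) : ((inner ℝ q x : ℝ) : EReal) - ψ x ≤ conj ψ q :=
  le_iSup (fun x => ((inner ℝ q x : ℝ) : EReal) - ψ x) x

theorem conj_ne_bot {ψ : EuclideanSpace ℝ (Fin n) → EReal} (hψ : IsProper ψ)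
    (q : EuclideanSpace ℝ (Fin n)) : conj ψ q ≠ ⊥ := by
  obtain ⟨x, hx⟩ := hψ.2
  intro h
  have h1 : ((inner ℝ q x : ℝ) : EReal) - ψ x ≤ ⊥ := h ▸ inner_sub_le_conj ψ q x
  lift ψ x to ℝ using ⟨ne_of_lt hx, hψ.1 x⟩ with v
  rw [← EReal.coe_sub] at h1
  exact EReal.coe_ne_bot _ (le_bot_iff.1 h1)

theorem conj_le_coe_iff {ψ : EuclideanSpace ℝ (Fin n) → EReal} (hψ : ∀ x, ψ x ≠ ⊥)
    (q : EuclideanSpace ℝ (Fin n)) (K : ℝ) :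
    conj ψ q ≤ K ↔ ∀ p ∈ epi ψ, inner ℝ q p.1 - p.2 ≤ K := by
  constructor
  · intro h p hp
    have h1 : ((inner ℝ q p.1 : ℝ) : EReal) - p.2 ≤ K :=
      (EReal.sub_le_sub le_rfl hp).trans ((inner_sub_le_conj ψ q p.1).trans h)
    exact_mod_cast h1
  · intro h
    refine iSup_le fun x => ?_
    by_cases hx : ψ x = ⊤
    · simp [hx]
    · have h1 := h (x, (ψ x).toReal) (EReal.le_coe_toReal hx)
      rw [← EReal.coe_toReal hx (hψ x)]
      exact_mod_cast h1

theorem IsProper.epi_nonempty {ψ : EuclideanSpace ℝ (Fin n) → EReal} (hψ : IsProper ψ) :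
    (epi ψ).Nonempty := by
  obtain ⟨x, hx⟩ := hψ.2
  exact ⟨(x, (ψ x).toReal), EReal.le_coe_toReal (ne_of_lt hx)⟩

/-- The suprema in `conj f q` and `conj g y` can be taken jointly and over the epigraphs, which
turns an inequality in `EReal` into inequalities between real numbers. -/
theorem add_conj_add_conj_le_coe_iff {f : EuclideanSpace ℝ (Fin n) → EReal}
    {g : EuclideanSpace ℝ (Fin m) → EReal} (hf : IsProper f) (hg : IsProper g) (β : ℝ)
    (q : EuclideanSpace ℝ (Fin n)) (y : EuclideanSpace ℝ (Fin m)) (K : ℝ) :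
    (β : EReal) + conj f q + conj g y ≤ K ↔
      ∀ p ∈ epi f, ∀ p' ∈ epi g,
        β + (inner ℝ q p.1 - p.2) + (inner ℝ y p'.1 - p'.2) ≤ K := by
  constructor
  · intro h p hp p' hp'
    have h1 : ((inner ℝ q p.1 : ℝ) : EReal) - p.2 ≤ conj f q :=
      (EReal.sub_le_sub le_rfl hp).trans (inner_sub_le_conj f q p.1)
    have h2 : ((inner ℝ y p'.1 : ℝ) : EReal) - p'.2 ≤ conj g y :=
      (EReal.sub_le_sub le_rfl hp').trans (inner_sub_le_conj g y p'.1)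
    have h3 := (add_le_add (add_le_add (le_refl (β : EReal)) h1) h2).trans h
    exact_mod_cast h3
  · intro h
    obtain ⟨p₀, hp₀⟩ := hf.epi_nonempty
    obtain ⟨p₁, hp₁⟩ := hg.epi_nonempty
    have hfle : conj f q ≤ ((K - β - (inner ℝ y p₁.1 - p₁.2) : ℝ) : EReal) :=
      (conj_le_coe_iff hf.1 _ _).2 fun p hp => by linarith [h p hp p₁ hp₁]
    have hfα := EReal.coe_toReal (hfle.trans_lt (EReal.coe_lt_top _)).ne (conj_ne_bot hf q)
    set α := (conj f q).toReal
    have hgle : conj g y ≤ ((K - β - α : ℝ) : EReal) := by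
      refine (conj_le_coe_iff hg.1 _ _).2 fun p' hp' => ?_
      have h1 : conj f q ≤ ((K - β - (inner ℝ y p'.1 - p'.2) : ℝ) : EReal) :=
        (conj_le_coe_iff hf.1 _ _).2 fun p hp => by linarith [h p hp p' hp']
      rw [← hfα, EReal.coe_le_coe_iff] at h1
      linarith
    rw [← hfα]
    refine (add_le_add le_rfl hgle).trans ?_
    exact_mod_cast (by linarith : β + α + (K - β - α) ≤ K)

end Conjugate

/-- Points strictly above the graph of a convex function, over a relative interior point of its
domain, are relative interior points of its epigraph. -/
theorem MemAlgRelint.epi {V : Type*} [AddCommGroup V] [Module ℝ V] {ψ : V → EReal}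
    (hconv : IsConvexFun ψ) {x : V} (hx : MemAlgRelint (dom ψ) x) :
    MemAlgRelint (epi ψ) (x, (ψ x).toReal + 1) := by
  have hmem : ∀ u ∈ dom ψ, (u, (ψ u).toReal) ∈ CCOP.epi ψ := fun u hu =>
    EReal.le_coe_toReal (ne_of_lt hu)
  have hup : ∀ {u : V} {σ τ : ℝ}, (u, σ) ∈ CCOP.epi ψ → σ ≤ τ → (u, τ) ∈ CCOP.epi ψ :=
    fun h hle => le_trans h (EReal.coe_le_coe_iff.2 hle)
  refine ⟨hup (hmem x hx.1) (by linarith), ?_⟩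
  rintro ⟨y, σ⟩ hy
  have hyd : y ∈ dom ψ := lt_of_le_of_lt hy (EReal.coe_lt_top _)
  obtain ⟨ε, hε, hu⟩ := hx.2 y hyd
  set u := (1 + ε) • x + (-ε) • y with hudef
  set t := (ψ x).toReal
  set τ := (ψ u).toReal
  -- On the segment from `x` to `u` the function lies below the chord, whose slope is bounded,
  -- so the slack `1` at `x` leaves room for a short step.
  set M := τ - t - ε * (t + 1 - σ) with hM
  have hpos : 0 < 1 + |M| := by positivity
  set θ := 1 / (1 + |M|) with hθ
  have hθ0 : 0 < θ := by positivity
  have hθ1 : θ ≤ 1 := by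
    rw [hθ, div_le_one hpos]
    linarith [abs_nonneg M]
  have hθM : θ * M ≤ 1 := by
    rw [hθ, one_div, inv_mul_le_iff₀ hpos]
    linarith [le_abs_self M]
  refine ⟨θ * ε, mul_pos hθ0 hε, ?_⟩
  have h := hconv (hmem x hx.1) (hmem u hu) (a := 1 - θ) (b := θ) (by linarith) hθ0.le (by ring)
  have hpt : (1 + θ * ε) • x + (-(θ * ε)) • y = (1 - θ) • x + θ • u := by
    rw [hudef]
    module
  simp only [Prod.smul_mk, Prod.mk_add_mk, smul_eq_mul] at h ⊢
  rw [hpt]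
  refine hup h ?_
  have : (1 - θ) * t + θ * τ = t + θ * M + θ * ε * (t + 1 - σ) := by rw [hM]; ring
  have h2 : (ψ u).toReal = τ := rfl
  have h3 : (ψ x).toReal = t := rfl
  rw [h2, h3]
  nlinarith

/-- Both cases of the Slater condition in one form: the epigraph is a convex set `C` cut by finitely
many affine inequalities, and some point over `x` satisfies the inequalities and lies in the
relative interior of `C`. In the relative interior case there are no inequalities; in the
polyhedral case `C` is the whole space. -/
theorem SlaterPoint.exists_epi_eq_inter {n : ℕ} {ψ : EuclideanSpace ℝ (Fin n) → EReal}
    (hconv : IsConvexFun ψ) {x : EuclideanSpace ℝ (Fin n)}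
    (hx : SlaterPoint ψ x) :
    ∃ (C : Set (EuclideanSpace ℝ (Fin n) × ℝ)) (t : ℝ) (k : ℕ)
      (φ : Fin k → (EuclideanSpace ℝ (Fin n) × ℝ) →ᵃ[ℝ] ℝ),
      Convex ℝ C ∧ MemAlgRelint C (x, t) ∧ (∀ i, φ i (x, t) ≤ 0) ∧
        ∀ p, p ∈ epi ψ ↔ p ∈ C ∧ ∀ i, φ i p ≤ 0 := by
  rcases hx with hx | ⟨⟨k, φ, β, hφ⟩, hx⟩
  · exact ⟨epi ψ, (ψ x).toReal + 1, 0, fun i => i.elim0, hconv,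
      (memAlgRelint_of_mem_intrinsicInterior hx).epi hconv, fun i => i.elim0,
      fun p => ⟨fun h => ⟨h, fun i => i.elim0⟩, fun h => h.1⟩⟩
  · have happ : ∀ i (p : EuclideanSpace ℝ (Fin n) × ℝ),
        ((φ i).toAffineMap - AffineMap.const ℝ (EuclideanSpace ℝ (Fin n) × ℝ) (β i)) p =
          φ i p - β i :=
      fun i p => rfl
    have hmem : ∀ p, p ∈ epi ψ ↔ ∀ i, φ i p ≤ β i := fun p => by rw [hφ]; rfl
    refine ⟨Set.univ, (ψ x).toReal, k, fun i => (φ i).toAffineMap - AffineMap.const ℝ _ (β i),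
      convex_univ, memAlgRelint_univ _, fun i => ?_, fun p => ?_⟩
    · rw [happ, sub_nonpos]
      exact (hmem _).1 (EReal.le_coe_toReal (ne_of_lt hx)) i
    · simp only [happ, sub_nonpos, hmem, Set.mem_univ, true_and]

/-! ### Strong duality for a fixed support of the multiplier -/

section Euclidean

variable {n m r : ℕ}

theorem inner_eq_sum_mul (x y : EuclideanSpace ℝ (Fin n)) : inner ℝ x y = ∑ i, x i * y i := by
  simp [PiLp.inner_apply, mul_comm]

theorem inner_transpose_toEuclideanLin (A : Matrix (Fin m) (Fin n) ℝ)
    (y : EuclideanSpace ℝ (Fin m)) (x : EuclideanSpace ℝ (Fin n)) :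
    inner ℝ (A.transpose.toEuclideanLin y) x = inner ℝ y (A.toEuclideanLin x) := by
  rw [← Matrix.conjTranspose_eq_transpose_of_trivial,
    Matrix.toEuclideanLin_conjTranspose_eq_adjoint, LinearMap.adjoint_inner_left]

end Euclidean

/-- The dual objective without its cardinality term. -/
noncomputable def convexDualObj {n m r : ℕ} (f : EuclideanSpace ℝ (Fin n) → EReal)
    (g : EuclideanSpace ℝ (Fin m) → EReal) (A : Matrix (Fin m) (Fin n) ℝ)
    (B : Matrix (Fin r) (Fin n) ℝ) (b : EuclideanSpace ℝ (Fin r))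
    (w : EuclideanSpace ℝ (Fin m) × EuclideanSpace ℝ (Fin r)) : EReal :=
  ((inner ℝ b w.2 : ℝ) : EReal)
    + conj f (-(A.transpose.toEuclideanLin w.1) - B.transpose.toEuclideanLin w.2)
    + conj g w.1

section Duality

variable {n m r : ℕ} {f : EuclideanSpace ℝ (Fin n) → EReal}
  {g : EuclideanSpace ℝ (Fin m) → EReal}

theorem convexDualObj_ne_bot (hf : IsProper f) (hg : IsProper g)
    (A : Matrix (Fin m) (Fin n) ℝ) (B : Matrix (Fin r) (Fin n) ℝ)
    (b : EuclideanSpace ℝ (Fin r)) (w : EuclideanSpace ℝ (Fin m) × EuclideanSpace ℝ (Fin r)) :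
    convexDualObj f g A B b w ≠ ⊥ := by
  simp [convexDualObj, EReal.add_eq_bot_iff, conj_ne_bot hf, conj_ne_bot hg]

/-- `convexDualObj` is minus the infimum of the Lagrangian over the two epigraphs. -/
theorem convexDualObj_le_coe_iff (hf : IsProper f) (hg : IsProper g)
    (A : Matrix (Fin m) (Fin n) ℝ) (B : Matrix (Fin r) (Fin n) ℝ)
    (b : EuclideanSpace ℝ (Fin r)) (w : EuclideanSpace ℝ (Fin m) × EuclideanSpace ℝ (Fin r))
    (K : ℝ) :
    convexDualObj f g A B b w ≤ K ↔
      ∀ p ∈ epi f, ∀ p' ∈ epi g,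
        -K ≤ p.2 + p'.2 + ∑ j, w.1 j * (A.toEuclideanLin p.1 j - p'.1 j)
          + ∑ i, w.2 i * (B.toEuclideanLin p.1 i - b i) := by
  rw [convexDualObj, add_conj_add_conj_le_coe_iff hf hg]
  refine forall₂_congr fun p _ => forall₂_congr fun p' _ => ?_
  rw [inner_sub_left, inner_neg_left, inner_transpose_toEuclideanLin,
    inner_transpose_toEuclideanLin, inner_eq_sum_mul w.1 p'.1, real_inner_comm w.2 b,
    inner_eq_sum_mul w.1, inner_eq_sum_mul w.2, inner_eq_sum_mul w.2]
  simp only [mul_sub, Finset.sum_sub_distrib]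
  constructor <;> intro h <;> linarith

/-- Strong duality: among all `(y, z)` with `z ≥ 0` supported in `I`, the convex part of the dual
objective attains a finite minimum. -/
theorem exists_convexDualObj_min (hf : IsProper f) (hfc : IsConvexFun f) (hg : IsProper g)
    (hgc : IsConvexFun g) (A : Matrix (Fin m) (Fin n) ℝ) (B : Matrix (Fin r) (Fin n) ℝ)
    (b : EuclideanSpace ℝ (Fin r)) {c₀ : ℝ}
    (hbdd : ∀ x, (c₀ : EReal) ≤ f x + g (A.toEuclideanLin x))
    {x₀ : EuclideanSpace ℝ (Fin n)} (hxf : SlaterPoint f x₀)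
    (hxg : SlaterPoint g (A.toEuclideanLin x₀)) (hxb : ∀ i, B.toEuclideanLin x₀ i ≤ b i)
    (I : Finset (Fin r)) :
    ∃ w : EuclideanSpace ℝ (Fin m) × EuclideanSpace ℝ (Fin r),
      (∀ i, 0 ≤ w.2 i) ∧ (∀ i, i ∉ I → w.2 i = 0) ∧ convexDualObj f g A B b w ≠ ⊤ ∧
        ∀ w' : EuclideanSpace ℝ (Fin m) × EuclideanSpace ℝ (Fin r), (∀ i, 0 ≤ w'.2 i) →
          (∀ i, i ∉ I → w'.2 i = 0) → convexDualObj f g A B b w ≤ convexDualObj f g A B b w' := by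
  classical
  obtain ⟨Cf, tf, kf, φf, hCf, hrif, hφf, hepif⟩ := hxf.exists_epi_eq_inter hfc
  obtain ⟨Cg, tg, kg, φg, hCg, hrig, hφg, hepig⟩ := hxg.exists_epi_eq_inter hgc
  -- `S` is the set of values of the primal problem constrained by `(B x)_i ≤ b_i`, `i ∈ I`.
  let S : Set ℝ := {v | ∃ x t τ, (x, t) ∈ epi f ∧ (A.toEuclideanLin x, τ) ∈ epi g ∧
    (∀ i ∈ I, B.toEuclideanLin x i ≤ b i) ∧ v = t + τ}
  have hSne : S.Nonempty := ⟨tf + tg, x₀, tf, tg, (hepif _).2 ⟨hrif.1, hφf⟩,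
    (hepig _).2 ⟨hrig.1, hφg⟩, fun i _ => hxb i, rfl⟩
  have hSbdd : BddBelow S := by
    refine ⟨c₀, ?_⟩
    rintro v ⟨x, t, τ, ht, hτ, -, rfl⟩
    have h := (hbdd x).trans (add_le_add ht hτ)
    exact_mod_cast h
  set v₀ := sInf S with hv₀
  let V := (EuclideanSpace ℝ (Fin n) × ℝ) × (EuclideanSpace ℝ (Fin m) × ℝ)
  let lin : (V →ₗ[ℝ] ℝ) → ℝ → (V →ᵃ[ℝ] ℝ) := fun L d => L.toAffineMap - AffineMap.const ℝ V d
  let eqA : Fin m → (V →ₗ[ℝ] ℝ) := fun j =>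
    (EuclideanSpace.proj j : EuclideanSpace ℝ (Fin m) →L[ℝ] ℝ).toLinearMap ∘ₗ
      (A.toEuclideanLin ∘ₗ LinearMap.fst ℝ _ _ ∘ₗ LinearMap.fst ℝ _ _
        - LinearMap.fst ℝ _ _ ∘ₗ LinearMap.snd ℝ _ _)
  let inB : Fin r → (V →ₗ[ℝ] ℝ) := fun i =>
    (EuclideanSpace.proj i : EuclideanSpace ℝ (Fin r) →L[ℝ] ℝ).toLinearMap ∘ₗ
      B.toEuclideanLin ∘ₗ LinearMap.fst ℝ _ _ ∘ₗ LinearMap.fst ℝ _ _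
  let obj : V →ₗ[ℝ] ℝ := LinearMap.snd ℝ _ _ ∘ₗ LinearMap.fst ℝ _ _
    + LinearMap.snd ℝ _ _ ∘ₗ LinearMap.snd ℝ _ _
  let a : (Fin kf ⊕ Fin kg) ⊕ (Fin m ⊕ Fin r) → V →ᵃ[ℝ] ℝ :=
    Sum.elim (Sum.elim (fun i => (φf i).comp AffineMap.fst) (fun i => (φg i).comp AffineMap.snd))
      (Sum.elim (fun j => lin (eqA j) 0) (fun i => lin (inB i) (b i)))
  have ha₁ : ∀ i (p : V), a (.inl (.inl i)) p = φf i p.1 := fun _ _ => rfl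
  have ha₂ : ∀ i (p : V), a (.inl (.inr i)) p = φg i p.2 := fun _ _ => rfl
  have ha₃ : ∀ j (p : V), a (.inr (.inl j)) p = A.toEuclideanLin p.1.1 j - p.2.1 j :=
    fun _ _ => sub_zero _
  have ha₄ : ∀ i (p : V), a (.inr (.inr i)) p = B.toEuclideanLin p.1.1 i - b i := fun _ _ => rfl
  have hobj : ∀ p : V, lin obj v₀ p = p.1.2 + p.2.2 - v₀ := fun _ => rfl
  obtain ⟨μ, hμ1, hμ2, hμ3⟩ := exists_multipliers (hCf.prod hCg) (hrif.prod hCf hCg hrig)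
    (lin obj v₀) a (Finset.univ.disjSum (Finset.disjSum ∅ I))
    (Finset.disjSum ∅ (Finset.univ.disjSum ∅))
    (by
      rw [Finset.disjoint_left]
      rintro ((i | i) | (i | i)) <;> simp)
    (by
      rintro ((i | i) | (i | i)) hi
      · exact hφf i
      · exact hφg i
      · simp at hi
      · rw [ha₄]
        exact sub_nonpos.2 (hxb i))
    (by
      rintro ((i | i) | (i | i)) hi
      · simp at hi
      · simp at hi
      · rw [ha₃]
        exact sub_self _
      · simp at hi)
    (by
      rintro ⟨⟨x, t⟩, ⟨s, τ⟩⟩ ⟨hC1, hC2⟩ h1 h2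
      have hs : s = A.toEuclideanLin x := by
        ext j
        have h := h2 (.inr (.inl j)) (by simp)
        rw [ha₃] at h
        exact (sub_eq_zero.1 h).symm
      subst hs
      rw [hobj, sub_nonneg]
      refine csInf_le hSbdd ⟨x, t, τ, (hepif _).2 ⟨hC1, fun i => ?_⟩,
        (hepig _).2 ⟨hC2, fun i => ?_⟩, fun i hi => ?_, rfl⟩
      · exact h1 (.inl (.inl i)) (by simp)
      · exact h1 (.inl (.inr i)) (by simp)
      · have h := h1 (.inr (.inr i)) (by simp [hi])
        rw [ha₄] at h
        exact sub_nonpos.1 h)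
  have hle : convexDualObj f g A B b (WithLp.toLp 2 fun j => μ (.inr (.inl j)),
      WithLp.toLp 2 fun i => μ (.inr (.inr i))) ≤ ((-v₀ : ℝ) : EReal) := by
    rw [convexDualObj_le_coe_iff hf hg, neg_neg]
    intro p hp p' hp'
    have h := hμ3 (p, p') ⟨((hepif p).1 hp).1, ((hepig p').1 hp').1⟩
    simp only [Fintype.sum_sum_type, ha₁, ha₂, ha₃, ha₄, hobj] at h
    have h1 : ∑ i, μ (.inl (.inl i)) * φf i p ≤ 0 := Finset.sum_nonpos fun i _ =>
      mul_nonpos_of_nonneg_of_nonpos (hμ1 _ (by simp)) (((hepif p).1 hp).2 i)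
    have h2 : ∑ i, μ (.inl (.inr i)) * φg i p' ≤ 0 := Finset.sum_nonpos fun i _ =>
      mul_nonpos_of_nonneg_of_nonpos (hμ1 _ (by simp)) (((hepig p').1 hp').2 i)
    linarith
  refine ⟨_, fun i => ?_, fun i hi => ?_, (hle.trans_lt (EReal.coe_lt_top _)).ne,
    fun w' hw0 hwI => hle.trans ?_⟩
  · by_cases hi : i ∈ I
    · exact hμ1 _ (by simp [hi])
    · exact (hμ2 (.inr (.inr i)) (by simp [hi]) (by simp)).ge
  · exact hμ2 (.inr (.inr i)) (by simp [hi]) (by simp)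
  · -- Weak duality: every dual value is at least `-v₀`.
    by_cases htop : convexDualObj f g A B b w' = ⊤
    · rw [htop]
      exact le_top
    have hK := EReal.coe_toReal htop (convexDualObj_ne_bot hf hg A B b w')
    set K := (convexDualObj f g A B b w').toReal
    have hw := (convexDualObj_le_coe_iff hf hg A B b w' K).1 hK.ge
    rw [← hK, EReal.coe_le_coe_iff, neg_le]
    refine le_csInf hSne ?_
    rintro v ⟨x, t, τ, ht, hτ, hx, rfl⟩
    have h := hw _ ht _ hτ
    simp only [sub_self, mul_zero, Finset.sum_const_zero, add_zero] at h
    have h1 : ∑ i, w'.2 i * (B.toEuclideanLin x i - b i) ≤ 0 := Finset.sum_nonpos fun i _ => by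
      by_cases hi : i ∈ I
      · exact mul_nonpos_of_nonneg_of_nonpos (hw0 i) (sub_nonpos.2 (hx i hi))
      · rw [hwI i hi, zero_mul]
    linarith

/-! ### The cardinality terms -/

theorem dualObj_eq (A : Matrix (Fin m) (Fin n) ℝ) (B : Matrix (Fin r) (Fin n) ℝ)
    (b : EuclideanSpace ℝ (Fin r)) (mu : Fin r → ℝ)
    (w : EuclideanSpace ℝ (Fin m) × EuclideanSpace ℝ (Fin r)) :
    dualObj f g A B b mu w = convexDualObj f g A B b w + PsiPos mu w.2 := rfl

theorem PsiPos_of_nonneg (mu : Fin r → ℝ) {z : EuclideanSpace ℝ (Fin r)} (hz : ∀ i, 0 ≤ z i) :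
    PsiPos mu z = ((∑ i, if z i ≠ 0 then mu i else 0 : ℝ) : EReal) := by
  rw [PsiPos, delta, if_pos (by exact hz), add_zero]

theorem PsiPos_of_not_nonneg (mu : Fin r → ℝ) {z : EuclideanSpace ℝ (Fin r)}
    (hz : ¬ ∀ i, 0 ≤ z i) : PsiPos mu z = ⊤ := by
  rw [PsiPos, delta, if_neg (by exact hz), EReal.coe_add_top]

theorem sub_sum_le_of_le_primalObj {A : Matrix (Fin m) (Fin n) ℝ} {B : Matrix (Fin r) (Fin n) ℝ}
    {b : EuclideanSpace ℝ (Fin r)} {lam : Fin r → ℝ} (hlam : ∀ i, 0 ≤ lam i) {c : ℝ}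
    {x : EuclideanSpace ℝ (Fin n)} (h : (c : EReal) ≤ primalObj f g A B b lam x) :
    ((c - ∑ i, lam i : ℝ) : EReal) ≤ f x + g (A.toEuclideanLin x) := by
  have hΦ : PhiPos lam (B.toEuclideanLin x - b) ≤ ∑ i, lam i :=
    Finset.sum_le_sum fun i _ => by
      split_ifs
      exacts [le_rfl, hlam i]
  have h1 : (c : EReal) ≤ f x + g (A.toEuclideanLin x) + ((∑ i, lam i : ℝ) : EReal) :=
    h.trans (add_le_add le_rfl (EReal.coe_le_coe_iff.2 hΦ))
  rw [EReal.coe_sub]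
  exact EReal.sub_le_of_le_add h1

end Duality

end CCOP

theorem mainTheorem3 {n m r : ℕ}
    (f : EuclideanSpace ℝ (Fin n) → EReal) (g : EuclideanSpace ℝ (Fin m) → EReal)
    (hf_proper : CCOP.IsProper f) (hf_lsc : LowerSemicontinuous f) (hf_conv : CCOP.IsConvexFun f)
    (hg_proper : CCOP.IsProper g) (hg_lsc : LowerSemicontinuous g) (hg_conv : CCOP.IsConvexFun g)
    (A : Matrix (Fin m) (Fin n) ℝ) (B : Matrix (Fin r) (Fin n) ℝ)
    (b : EuclideanSpace ℝ (Fin r))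
    (lam mu : Fin r → ℝ) (hlam : ∀ i, 0 < lam i) (hmu : ∀ i, 0 < mu i)
    (hbdd : ∃ c : ℝ, ∀ x, (c : EReal) ≤ CCOP.primalObj f g A B b lam x)
    (hslater : ∃ x : EuclideanSpace ℝ (Fin n),
      CCOP.SlaterPoint f x ∧ CCOP.SlaterPoint g (A.toEuclideanLin x) ∧
        ∀ i, B.toEuclideanLin x i ≤ b i) :
    ∃ w : EuclideanSpace ℝ (Fin m) × EuclideanSpace ℝ (Fin r),
      (∃ v : ℝ, CCOP.dualObj f g A B b mu w = (v : EReal)) ∧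
        ∀ w', CCOP.dualObj f g A B b mu w ≤ CCOP.dualObj f g A B b mu w' := by
  classical
  obtain ⟨c, hc⟩ := hbdd
  obtain ⟨x₀, hxf, hxg, hxb⟩ := hslater
  choose w hw0 hwI hwtop hwmin using CCOP.exists_convexDualObj_min hf_proper hf_conv hg_proper
    hg_conv A B b
    (fun x => CCOP.sub_sum_le_of_le_primalObj (fun i => (hlam i).le) (hc x))
    hxf hxg hxb
  obtain ⟨I, -, hI⟩ := Finset.exists_min_image Finset.univ
    (fun I : Finset (Fin r) => CCOP.dualObj f g A B b mu (w I)) Finset.univ_nonempty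
  refine ⟨w I, ?_, fun w' => ?_⟩
  · refine ⟨(CCOP.convexDualObj f g A B b (w I)).toReal
      + ∑ i, if (w I).2 i ≠ 0 then mu i else 0, ?_⟩
    rw [CCOP.dualObj_eq, CCOP.PsiPos_of_nonneg mu (hw0 I), EReal.coe_add,
      EReal.coe_toReal (hwtop I) (CCOP.convexDualObj_ne_bot hf_proper hg_proper A B b (w I))]
  · by_cases hz : ∀ i, 0 ≤ w'.2 i
    · -- Compare with the minimizer for the support `I'` of `w'.2`.
      let I' : Finset (Fin r) := Finset.univ.filter fun i => w'.2 i ≠ 0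
      refine (hI I' (Finset.mem_univ _)).trans ?_
      simp only [CCOP.dualObj_eq, CCOP.PsiPos_of_nonneg mu hz, CCOP.PsiPos_of_nonneg mu (hw0 I')]
      refine add_le_add (hwmin I' w' hz fun i hi => by simpa [I'] using hi)
        (EReal.coe_le_coe_iff.2 (Finset.sum_le_sum fun i _ => ?_))
      by_cases hi : w'.2 i = 0
      · rw [if_neg (not_not.2 (hwI I' i (by simp [I', hi])))]
        simp [hi]
      · rw [if_pos hi]
        split_ifs
        exacts [le_rfl, (hmu i).le]
    · rw [CCOP.dualObj_eq _ _ _ _ w', CCOP.PsiPos_of_not_nonneg mu hz,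
        EReal.add_top_of_ne_bot (CCOP.convexDualObj_ne_bot hf_proper hg_proper A B b w')]
      exact le_top
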